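/- Let $k$ be an algebraically closed field and let $\mathcal C$ be a $k$-linear, Hom-finite, Krull–Schmidt triangulated category with shift $\Sigma$ and with a Serre functor $\mathcal S$, i.e. a self-equivalence of $\mathcal C$ with isomorphisms $D\mathrm{Hom}(X,Y)\cong\mathrm{Hom}(Y,\mathcal S X)$ natural in $X$ and $Y$, where $D=\mathrm{Hom}_k(-,k)$. An Auslander–Reiten triangle is a distinguished triangle $X\to Y\xrightarrow{v} Z\xrightarrow{w}\Sigma X$ with $X,Z$ indecomposable, $w\neq 0$, and such that every morphism $W\to Z$ that is not a split epimorphism factors through $v$; a morphism is called almost vanishing if it is (up to an isomorphism of its codomain with some $\Sigma X$) the third morphism $w$ of such a triangle. The support of a natural transformation $\alpha$ is the set of isomorphism classes of indecomposable objects $U$ with $\alpha_U\neq 0$. Let $M$ be an indecomposable object of $\mathcal C$ such that there is no irreducible map $\Sigma^rM\to M$ for any $r\in\mathbb Z$. Let $F:\mathcal C\to\mathcal C$ be a $k$-linear endofunctor such that $F(\Sigma^rM)$ is indecomposable for all $r\in\mathbb Z$ (for example a power of $\Sigma$, or any $k$-linear self-equivalence). Let $\alpha:\mathrm{Id}_{\mathcal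 C}\to F$ be a natural transformation whose support is contained in $\{\Sigma^rM\mid r\in\mathbb Z\}$. (1) For every $r\in\mathbb Z$ with $\alpha_{\Sigma^rM}\neq0$ one has $F(\Sigma^rM)\cong\mathcal S(\Sigma^rM)$, and $\alpha_{\Sigma^rM}:\Sigma^rM\to F(\Sigma^rM)$ is almost vanishing. (2) Suppose that the support of $\alpha$ is equal to $\{\Sigma^rM\mid r\in\mathbb Z\}$, or that $\alpha\neq0$ and $\alpha$ commutes with $\Sigma$ up to a sign, i.e. there are a natural isomorphism $\varphi:F\Sigma\cong\Sigma F$ and a sign $\varepsilon\in\{1,-1\}$ with $\varphi_X\circ\alpha_{\Sigma X}=\varepsilon\,\Sigma(\alpha_X)$ for all $X$ (for example, $\alpha$ is a non-zero homogeneous element of the graded center of $\mathcal C$). Then $F(M)\cong\mathcal S(M)$, and $\alpha_{\Sigma^rM}$ is almost vanishing for every $r\in\mathbb Z$. Thus $\alpha$ is a transformation of the kind constructed by Linckelmann: for every $r$ one has $F(\Sigma^rM)\cong\mathcal S(\Sigma^rM)$ and $\alpha_{\Sigma^rM}$ is almost vanishing, and $\alpha_V=0$ for every indecomposable object $V$ that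 is not isomorphic to any $\Sigma^rM$. -/

import Mathlib

open CategoryTheory CategoryTheory.Limits CategoryTheory.Pretriangulated

universe w v u

namespace ARTheory

section Basic

variable {C : Type u} [Category.{v} C]

/-- An irreducible morphism: neither a split monomorphism nor a split epimorphism, and in each
factorization `f = g ≫ h` either `g` is a split monomorphism or `h` is a split epimorphism. -/
def IsIrreducibleMap {X Y : C} (f : X ⟶ Y) : Prop :=
  ¬ IsSplitMono f ∧ ¬ IsSplitEpi f ∧
    ∀ (Z : C) (g : X ⟶ Z) (h : Z ⟶ Y), g ≫ h = f → IsSplitMono g ∨ IsSplitEpi h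

end Basic

section KrullSchmidt

variable (C : Type u) [Category.{v} C] [Preadditive C]

/-- Every object is a finite direct sum of objects with local endomorphism rings. -/
def IsKrullSchmidt : Prop :=
  ∀ X : C, ∃ (n : ℕ) (Y : Fin n → C) (b : Bicone Y),
    Nonempty b.IsBilimit ∧ Nonempty (X ≅ b.pt) ∧ ∀ i, IsLocalRing (End (Y i))

end KrullSchmidt

section Linear

variable (k : Type w) [Field k] {C : Type u} [Category.{v} C] [Preadditive C] [Linear k C]

/-- `S` is a Serre functor: a self-equivalence with `k`-linear isomorphisms
`D Hom(X, Y) ≅ Hom(Y, S X)`, natural in `X` and in `Y`, where `D` is the `k`-dual. -/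
def IsSerreFunctor (S : C ⥤ C) : Prop :=
  S.IsEquivalence ∧
    ∃ e : ∀ X Y : C, Module.Dual k (X ⟶ Y) ≃ₗ[k] (Y ⟶ S.obj X),
      (∀ {X X' : C} (Y : C) (f : X ⟶ X') (ξ : Module.Dual k (X ⟶ Y)),
        e X' Y (ξ ∘ₗ Linear.leftComp k Y f) = e X Y ξ ≫ S.map f) ∧
      (∀ (X : C) {Y Y' : C} (g : Y' ⟶ Y) (ξ : Module.Dual k (X ⟶ Y)),
        e X Y' (ξ ∘ₗ Linear.rightComp k X g) = g ≫ e X Y ξ)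

end Linear

section Triangulated

variable {C : Type u} [Category.{v} C] [HasZeroObject C] [HasShift C ℤ] [Preadditive C]
  [∀ n : ℤ, (shiftFunctor C n).Additive] [Pretriangulated C]

/-- An Auslander–Reiten triangle `X ⟶ Y ⟶ Z ⟶ X⟦1⟧`. -/
structure IsAuslanderReitenTriangle (T : Triangle C) : Prop where
  distinguished : T ∈ distTriang C
  indecomposable₁ : Indecomposable T.obj₁
  indecomposable₃ : Indecomposable T.obj₃
  mor₃_ne_zero : T.mor₃ ≠ 0
  lift : ∀ (W : C) (f : W ⟶ T.obj₃), ¬ IsSplitEpi f → ∃ g : W ⟶ T.obj₂, g ≫ T.mor₂ = f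

/-- A morphism `f : Z ⟶ W` is almost vanishing if it is the third morphism of an
Auslander–Reiten triangle (up to an identification of `W` with some `X⟦1⟧`). -/
def IsAlmostVanishing {Z W : C} (f : Z ⟶ W) : Prop :=
  ∃ (X Y : C) (a : X ⟶ Y) (b : Y ⟶ Z) (e : W ≅ X⟦(1 : ℤ)⟧),
    IsAuslanderReitenTriangle (Triangle.mk a b (f ≫ e.hom))

/-- The support of a natural transformation, as an isomorphism-closed class of objects: all the
indecomposable objects at which the transformation does not vanish. -/
def natSupport {F G : C ⥤ C} (α : F ⟶ G) : Set C :=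
  {X | Indecomposable X ∧ α.app X ≠ 0}

/-- The `Σ`-orbit of `M`, as an isomorphism-closed class of objects. -/
def shiftOrbit (M : C) : Set C :=
  {X | ∃ r : ℤ, Nonempty (X ≅ M⟦r⟧)}

/-- `α : Id ⟶ F` commutes with the shift up to a sign: for some natural isomorphism
`φ : F Σ ≅ Σ F` and some sign `ε` one has `φ_X ∘ α_{Σ X} = ε Σ(α_X)` for all `X`.
For `F = Σ^n`, the canonical `φ` and `ε = (-1)^n`, this is membership in the
degree `n` part of the graded center. -/
def CommutesWithShiftUpToSign {F : C ⥤ C} (α : 𝟭 C ⟶ F) : Prop :=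
  ∃ (φ : shiftFunctor C (1 : ℤ) ⋙ F ≅ F ⋙ shiftFunctor C (1 : ℤ)) (ε : ℤˣ),
    ∀ X : C, α.app (X⟦(1 : ℤ)⟧) ≫ φ.hom.app X = (ε : ℤ) • (α.app X)⟦(1 : ℤ)⟧'

/-- `α : Id ⟶ F` is a Linckelmann transformation at `M`, for the Serre functor `S`: at each shift
`M⟦r⟧` it is an almost vanishing morphism `M⟦r⟧ ⟶ F (M⟦r⟧) ≅ S (M⟦r⟧)`, and it vanishes at
all the indecomposable objects outside the shift orbit of `M`. -/
structure IsLinckelmannTransformation (S : C ⥤ C) (M : C) {F : C ⥤ C} (α : 𝟭 C ⟶ F) : Prop where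
  obj_iso : ∀ r : ℤ, Nonempty (F.obj (M⟦r⟧) ≅ S.obj (M⟦r⟧))
  almostVanishing : ∀ r : ℤ, IsAlmostVanishing (α.app (M⟦r⟧))
  vanishing : ∀ V : C, Indecomposable V → V ∉ shiftOrbit M → α.app V = 0

end Triangulated

end ARTheory

/-! Write `Z` for a shift of `M`. Serre duality gives a right minimal right almost split `p : E ⟶ Z`
(`exists_rightMinimal_rightAlmostSplit`). Its restriction to each indecomposable summand of `E` is
irreducible (`isIrreducibleMap_component`), so no summand lies in the shift orbit, and `α` vanishes
on `E`. A `g` into `Z` that is not a split epimorphism factors through `p`, so naturality gives `g ≫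
α_Z = 0` (`comp_app_eq_zero`).

A non-zero map out of `Z` with this property and with indecomposable target is almost vanishing, and
Serre duality forces its target to be `S Z`. Under either hypothesis of the second part, `α` is
non-zero at every shift of `M`. -/

namespace ARTheory

/-! ### Local endomorphism rings and Krull–Schmidt decompositions -/

section Local

variable {C : Type u} [Category.{v} C] [Preadditive C]

lemma isLocalRing_end_iff {X : C} : IsLocalRing (End X) ↔
    ¬ IsZero X ∧ ∀ f : X ⟶ X, IsIso f ∨ IsIso (𝟙 X - f) := by
  constructor
  · intro h
    refine ⟨fun h0 ↦ one_ne_zero (α := End X) (h0.eq_of_src _ _), fun f ↦ ?_⟩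
    rcases IsLocalRing.isUnit_or_isUnit_of_add_one (R := End X)
      (add_sub_cancel (G := End X) f 1) with h | h
    · exact Or.inl ((isUnit_iff_isIso _).1 h)
    · exact Or.inr ((isUnit_iff_isIso _).1 h)
  · rintro ⟨h0, h⟩
    have : Nontrivial (End X) := ⟨⟨1, 0, fun h1 ↦ h0 ((IsZero.iff_id_eq_zero X).2 h1)⟩⟩
    refine ⟨fun {f g} hfg ↦ ?_⟩
    obtain rfl : g = 1 - f := eq_sub_of_add_eq' hfg
    rcases h f with h | h
    · exact Or.inl ((isUnit_iff_isIso _).2 h)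
    · exact Or.inr ((isUnit_iff_isIso _).2 h)

lemma isLocalRing_end_of_iso {X Y : C} (i : X ≅ Y) (h : IsLocalRing (End X)) :
    IsLocalRing (End Y) := by
  rw [isLocalRing_end_iff] at h ⊢
  refine ⟨fun h0 ↦ h.1 (h0.of_iso i), fun f ↦ ?_⟩
  have aux (g : X ⟶ X) (hg : IsIso g) : IsIso (i.inv ≫ g ≫ i.hom) := inferInstance
  rcases h.2 (i.hom ≫ f ≫ i.inv) with h | h
  · exact Or.inl (by simpa using aux _ h)
  · exact Or.inr (by simpa using aux _ h)

lemma isLocalRing_end_map {D : Type*} [Category D] [Preadditive D] (G : C ⥤ D) [G.Additive]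
    [G.Full] [G.Faithful] {X : C} (h : IsLocalRing (End X)) : IsLocalRing (End (G.obj X)) := by
  rw [isLocalRing_end_iff] at h ⊢
  refine ⟨fun h0 ↦ h.1 ?_, fun f ↦ ?_⟩
  · rw [IsZero.iff_id_eq_zero] at h0 ⊢
    exact G.map_injective (by simpa using h0)
  · obtain ⟨f, rfl⟩ := G.map_surjective f
    rcases h.2 f with h | h
    · exact Or.inl inferInstance
    · right
      have : IsIso (G.map (𝟙 X - f)) := inferInstance
      simpa using this

lemma indecomposable_of_isLocalRing_end [HasBinaryBiproducts C] {X : C}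
    (h : IsLocalRing (End X)) : Indecomposable X := by
  refine ⟨(isLocalRing_end_iff.1 h).1, fun Y Z i ↦ ?_⟩
  rcases (isLocalRing_end_iff.1 (isLocalRing_end_of_iso i h)).2 (biprod.fst ≫ biprod.inl)
    with h | h
  · right
    rw [IsZero.iff_id_eq_zero]
    have : (biprod.inr : Z ⟶ Y ⊞ Z) = 0 := by
      rw [← cancel_mono ((biprod.fst : Y ⊞ Z ⟶ Y) ≫ (biprod.inl : Y ⟶ Y ⊞ Z))]; simp
    rw [← biprod.inr_snd (X := Y), this, zero_comp]
  · left
    rw [IsZero.iff_id_eq_zero]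
    have : (biprod.inl : Y ⟶ Y ⊞ Z) = 0 := by
      rw [← cancel_mono (𝟙 (Y ⊞ Z) - biprod.fst ≫ biprod.inl)]; simp
    rw [← biprod.inl_fst (Y := Z), this, zero_comp]

/-- The identity of `X` is a sum of maps through indecomposable summands, and naturality moves `α`
onto those. Only retracts of `X` need testing. -/
lemma app_eq_zero_of_indecomposable [HasBinaryBiproducts C] (hKS : IsKrullSchmidt C) {F G : C ⥤ C} (α : F ⟶ G)
    [F.Additive] (X : C)
    (h : ∀ (Y : C) (f : Y ⟶ X) (g : X ⟶ Y), f ≫ g = 𝟙 Y → Indecomposable Y → α.app Y = 0) :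
    α.app X = 0 := by
  obtain ⟨n, Y, b, ⟨hb⟩, ⟨i⟩, hY⟩ := hKS X
  have key : 𝟙 X = ∑ j, (i.hom ≫ b.π j) ≫ (b.ι j ≫ i.inv) := by
    have := congr(i.hom ≫ $(CategoryTheory.Limits.IsBilimit.total hb) ≫ i.inv)
    simpa [Preadditive.comp_sum, Preadditive.sum_comp] using this.symm
  have : F.map (𝟙 X) ≫ α.app X = 0 := by
    rw [key, F.map_sum, Preadditive.sum_comp]
    refine Finset.sum_eq_zero fun j _ ↦ ?_
    rw [F.map_comp, Category.assoc, α.naturality,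
      reassoc_of% h (Y j) (b.ι j ≫ i.inv) (i.hom ≫ b.π j) (by simp)
        (indecomposable_of_isLocalRing_end (hY j))]
    simp
  simpa using this

/-- In a local endomorphism algebra the non-isomorphisms form a proper subspace, so a functional
separates it from the identity. -/
lemma exists_dual_end {k : Type w} [Field k] [Linear k C] {X : C} (hX : IsLocalRing (End X)) :
    ∃ ξ : Module.Dual k (X ⟶ X), ξ (𝟙 X) ≠ 0 ∧ ∀ f : X ⟶ X, ¬ IsIso f → ξ f = 0 := by
  let N : Submodule k (X ⟶ X) :=
    { carrier := {f | ¬ IsIso f}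
      zero_mem' := fun h ↦ (isLocalRing_end_iff.1 hX).1
        ((IsZero.iff_id_eq_zero X).2 (by rw [← IsIso.inv_hom_id (0 : X ⟶ X), comp_zero]))
      add_mem' := fun {f g} hf hg ↦ by
        have hf' : f ∈ nonunits (End X) := fun h ↦ hf ((isUnit_iff_isIso _).1 h)
        have hg' : g ∈ nonunits (End X) := fun h ↦ hg ((isUnit_iff_isIso _).1 h)
        exact fun h ↦ IsLocalRing.nonunits_add hf' hg' ((isUnit_iff_isIso _).2 h)
      smul_mem' := fun c f hf h ↦ by
        refine hf ⟨c • inv (c • f), ?_, ?_⟩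
        · rw [Linear.comp_smul, ← Linear.smul_comp, IsIso.hom_inv_id]
        · rw [Linear.smul_comp, ← Linear.comp_smul, IsIso.inv_hom_id] }
  have hN : 𝟙 X ∉ N := fun h ↦ h inferInstance
  obtain ⟨ξ, h1, h2⟩ := Submodule.exists_le_ker_of_notMem hN
  exact ⟨ξ, h1, fun f hf ↦ h2 hf⟩

end Local

/-! ### Irreducible maps under isomorphisms and equivalences -/

section Irreducible

variable {C : Type u} [Category.{v} C]

lemma isSplitMono_of_comp {X Y Z : C} (f : X ⟶ Y) (g : Y ⟶ Z) (h : IsSplitMono (f ≫ g)) :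
    IsSplitMono f :=
  ⟨⟨g ≫ retraction (f ≫ g), by rw [← Category.assoc, IsSplitMono.id]⟩⟩

lemma isSplitEpi_of_comp {X Y Z : C} (f : X ⟶ Y) (g : Y ⟶ Z) (h : IsSplitEpi (f ≫ g)) :
    IsSplitEpi g :=
  ⟨⟨section_ (f ≫ g) ≫ f, by rw [Category.assoc, IsSplitEpi.id]⟩⟩

lemma IsIrreducibleMap.iso_comp_iso {X Y X' Y' : C} {f : X ⟶ Y} (hf : IsIrreducibleMap f)
    (i : X' ≅ X) (j : Y ≅ Y') : IsIrreducibleMap (i.hom ≫ f ≫ j.hom) := by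
  have hmono {Z : C} (g : X' ⟶ Z) (h : IsSplitMono (i.inv ≫ g)) : IsSplitMono g := by
    have : IsSplitMono (i.hom ≫ i.inv ≫ g) := inferInstance
    simpa using this
  have hepi {Z : C} (g : Z ⟶ Y') (h : IsSplitEpi (g ≫ j.inv)) : IsSplitEpi g := by
    have : IsSplitEpi ((g ≫ j.inv) ≫ j.hom) := inferInstance
    simpa using this
  refine ⟨fun h ↦ hf.1 ?_, fun h ↦ hf.2.1 ?_, fun Z g h hgh ↦ ?_⟩
  · have : IsSplitMono (i.inv ≫ i.hom ≫ f ≫ j.hom) := inferInstance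
    exact isSplitMono_of_comp f j.hom (by simpa using this)
  · have : IsSplitEpi ((i.hom ≫ f ≫ j.hom) ≫ j.inv) := inferInstance
    exact isSplitEpi_of_comp i.hom f (by simpa using this)
  · exact (hf.2.2 Z (i.inv ≫ g) (h ≫ j.inv) (by simp [reassoc_of% hgh])).imp (hmono g) (hepi h)

lemma IsIrreducibleMap.map {D : Type*} [Category D] (G : C ⥤ D) [G.IsEquivalence] {X Y : C}
    {f : X ⟶ Y} (hf : IsIrreducibleMap f) : IsIrreducibleMap (G.map f) := by
  have hmono {A B : C} (g : A ⟶ B) (h : IsSplitMono (G.map g)) : IsSplitMono g :=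
    ⟨⟨G.preimage (retraction (G.map g)), G.map_injective (by simp)⟩⟩
  have hepi {A B : C} (g : A ⟶ B) (h : IsSplitEpi (G.map g)) : IsSplitEpi g :=
    ⟨⟨G.preimage (section_ (G.map g)), G.map_injective (by simp)⟩⟩
  refine ⟨fun h ↦ hf.1 (hmono f h), fun h ↦ hf.2.1 (hepi f h), fun Z g h hgh ↦ ?_⟩
  let i := G.objObjPreimageIso Z
  obtain ⟨g', hg'⟩ := G.map_surjective (g ≫ i.inv)
  obtain ⟨h', hh'⟩ := G.map_surjective (i.hom ≫ h)
  refine (hf.2.2 _ g' h' (G.map_injective (by simp [hg', hh', hgh]))).imp (fun H ↦ ?_) fun H ↦ ?_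
  · refine isSplitMono_of_comp g i.inv ?_
    rw [← hg']
    exact ⟨⟨(H.exists_splitMono.some).map G⟩⟩
  · refine isSplitEpi_of_comp i.hom h ?_
    rw [← hh']
    exact ⟨⟨(H.exists_splitEpi.some).map G⟩⟩

lemma app_eq_zero_iff_of_iso [HasZeroMorphisms C] {F : C ⥤ C} (α : 𝟭 C ⟶ F) {X Y : C} (i : X ≅ Y) :
    α.app X = 0 ↔ α.app Y = 0 := by
  have h : i.hom ≫ α.app Y = α.app X ≫ F.map i.hom := α.naturality i.hom
  constructor
  · intro h0
    rw [← cancel_epi i.hom, h, h0, zero_comp, comp_zero]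
  · intro h0
    rw [← cancel_mono (F.map i.hom), ← h, h0, zero_comp, comp_zero]

end Irreducible

/-! ### The shift orbit and shift-compatible transformations -/

section Shift

variable {C : Type u} [Category.{v} C] [HasShift C ℤ]

lemma not_mem_shiftOrbit_of_isIrreducibleMap {M : C}
    (hirr : ∀ (r : ℤ) (f : M⟦r⟧ ⟶ M), ¬ IsIrreducibleMap f) {Y : C} {r : ℤ} {f : Y ⟶ M⟦r⟧}
    (hf : IsIrreducibleMap f) : Y ∉ shiftOrbit M := by
  rintro ⟨s, ⟨i⟩⟩
  exact hirr (s + -r) _ ((hf.map (shiftFunctor C (-r))).iso_comp_iso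
    (shiftAdd M s (-r) ≪≫ (shiftFunctor C (-r)).mapIso i.symm) (shiftShiftNeg M r))

variable [Preadditive C] [∀ n : ℤ, (shiftFunctor C n).Additive]

lemma CommutesWithShiftUpToSign.app_shift_one_eq_zero_iff {F : C ⥤ C} {α : 𝟭 C ⟶ F}
    (h : CommutesWithShiftUpToSign α) (X : C) : α.app (X⟦(1 : ℤ)⟧) = 0 ↔ α.app X = 0 := by
  obtain ⟨φ, ε, h⟩ := h
  have h1 : α.app (X⟦(1 : ℤ)⟧) = 0 ↔ (α.app X)⟦(1 : ℤ)⟧' = 0 := by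
    rw [← cancel_mono (φ.hom.app X), zero_comp]
    erw [h X]
    rcases Int.units_eq_one_or ε with rfl | rfl <;> simp
  rw [h1, Functor.map_eq_zero_iff]

lemma CommutesWithShiftUpToSign.app_shift_eq_zero_iff {F : C ⥤ C} {α : 𝟭 C ⟶ F}
    (h : CommutesWithShiftUpToSign α) (X : C) (r : ℤ) : α.app (X⟦r⟧) = 0 ↔ α.app X = 0 := by
  have step (s : ℤ) : α.app (X⟦s + 1⟧) = 0 ↔ α.app (X⟦s⟧) = 0 :=
    (app_eq_zero_iff_of_iso α (shiftAdd X s 1)).trans (h.app_shift_one_eq_zero_iff _)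
  induction r using Int.induction_on with
  | zero => exact app_eq_zero_iff_of_iso α (shiftZero ℤ X)
  | succ i hi => exact (step i).trans hi
  | pred i hi => rwa [← step, sub_add_cancel]

end Shift

/-! ### Almost split maps and Serre duality -/

section Triangulated

variable {C : Type u} [Category.{v} C] [HasZeroObject C] [HasShift C ℤ] [Preadditive C]
  [∀ n : ℤ, (shiftFunctor C n).Additive] [Pretriangulated C]

/-- The triangle on a split monomorphism splits, so its cone is a complement in `X` and must vanish.
-/
lemma _root_.CategoryTheory.Indecomposable.isIso_of_isSplitMono {X Y : C} (hX : Indecomposable X) (hY : ¬ IsZero Y)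
    (s : Y ⟶ X) [IsSplitMono s] : IsIso s := by
  obtain ⟨Z, g, h, hT⟩ := distinguished_cocone_triangle s
  have h0 : h = 0 := (Triangle.mor₃_eq_zero_iff_mono₁ _ hT).2 (inferInstanceAs (Mono s))
  obtain ⟨e, -, -⟩ := exists_iso_binaryBiproduct_of_distTriang _ hT h0
  exact (Triangle.isZero₃_iff_isIso₁ _ hT).1 ((hX.2 _ _ e).resolve_left hY)

lemma _root_.CategoryTheory.Indecomposable.isIso_of_isSplitEpi {X Y : C} (hX : Indecomposable X) (hY : ¬ IsZero Y)
    (p : X ⟶ Y) [IsSplitEpi p] : IsIso p := by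
  have : IsSplitMono (section_ p) := ⟨⟨p, by simp⟩⟩
  have := hX.isIso_of_isSplitMono hY (section_ p)
  have : p = inv (section_ p) := by rw [← cancel_epi (section_ p)]; simp
  rw [this]
  infer_instance

lemma _root_.CategoryTheory.Indecomposable.isLocalRing_end (hKS : IsKrullSchmidt C) {X : C} (hX : Indecomposable X) :
    IsLocalRing (End X) := by
  obtain ⟨n, Y, b, ⟨hb⟩, ⟨i⟩, hY⟩ := hKS X
  have hn : Nonempty (Fin n) := by
    by_contra hn
    rw [not_nonempty_iff] at hn
    refine hX.1 (IsZero.of_iso ?_ i)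
    rw [IsZero.iff_id_eq_zero, ← CategoryTheory.Limits.IsBilimit.total hb, Finset.univ_eq_empty, Finset.sum_empty]
  obtain ⟨j⟩ := hn
  let s : Y j ⟶ X := b.ι j ≫ i.inv
  have : IsSplitMono s := ⟨⟨i.hom ≫ b.π j, by simp [s]⟩⟩
  have := hX.isIso_of_isSplitMono (isLocalRing_end_iff.1 (hY j)).1 s
  exact isLocalRing_end_of_iso (asIso s) (hY j)

lemma _root_.CategoryTheory.Indecomposable.shift (hKS : IsKrullSchmidt C) {X : C} (hX : Indecomposable X) (r : ℤ) :
    Indecomposable (X⟦r⟧) :=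
  indecomposable_of_isLocalRing_end
    (isLocalRing_end_map (shiftFunctor C r) (hX.isLocalRing_end hKS))

variable {k : Type w} [Field k] [Linear k C]

/-- In the presence of a Serre functor, each indecomposable object `Z` is the target of a
right minimal right almost split morphism. -/
lemma exists_rightMinimal_rightAlmostSplit (hKS : IsKrullSchmidt C) {S : C ⥤ C}
    (hS : IsSerreFunctor k S) {Z : C} (hZ : Indecomposable Z) :
    ∃ (E : C) (p : E ⟶ Z), ¬ IsSplitEpi p ∧
      (∀ (W : C) (f : W ⟶ Z), ¬ IsSplitEpi f → ∃ g : W ⟶ E, g ≫ p = f) ∧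
      ∀ φ : E ⟶ E, φ ≫ p = p → IsIso φ := by
  have hloc := hZ.isLocalRing_end hKS
  obtain ⟨hSeq, e, he₁, he₂⟩ := hS
  have : S.Additive := S.additive_of_preserves_binary_products
  have hSloc := isLocalRing_end_map S hloc
  obtain ⟨ξ, hξ₁, hξ⟩ := exists_dual_end (k := k) hloc
  set q : Z ⟶ S.obj Z := e Z Z ξ with hq
  have hq0 : q ≠ 0 := fun h ↦ hξ₁ (by
    rw [hq, LinearEquiv.map_eq_zero_iff] at h
    simp [h])
  obtain ⟨E, p, t, hT⟩ := distinguished_cocone_triangle₁ q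
  have hpq : p ≫ q = 0 := comp_distTriang_mor_zero₁₂ _ hT
  refine ⟨E, p, fun h ↦ hq0 ?_, fun W f hf ↦ ?_, fun φ hφ ↦ ?_⟩
  · rw [← cancel_epi p, hpq, comp_zero]
  · have : f ≫ q = 0 := by
      rw [hq, ← he₂]
      convert map_zero (e Z W)
      ext h
      -- By naturality `f ≫ q` corresponds to `h ↦ ξ (h ≫ f)`; an invertible `h ≫ f` would split
      -- `f`.
      refine hξ (h ≫ f) fun hi ↦ hf ⟨⟨inv (h ≫ f) ≫ h, ?_⟩⟩
      rw [Category.assoc, IsIso.inv_hom_id]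
    obtain ⟨g, hg⟩ := Triangle.coyoneda_exact₂ _ hT f this
    exact ⟨g, hg.symm⟩
  · obtain ⟨χ, h₁, h₂⟩ := complete_distinguished_triangle_morphism _ _ hT hT φ (𝟙 Z)
      ((Category.comp_id p).trans hφ.symm)
    change S.obj Z ⟶ S.obj Z at χ
    change q ≫ χ = 𝟙 Z ≫ q at h₁
    -- Since `q ≫ χ = q` and `q ≠ 0`, the map `𝟙 - χ` cannot be invertible.
    have hχ : IsIso χ := by
      refine ((isLocalRing_end_iff.1 hSloc).2 χ).resolve_right fun h ↦ hq0 ?_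
      rw [← cancel_mono (𝟙 (S.obj Z) - χ), Preadditive.comp_sub, h₁]
      simp
    let Φ : Triangle.mk p q t ⟶ Triangle.mk p q t :=
      { hom₁ := φ, hom₂ := 𝟙 Z, hom₃ := χ
        comm₁ := (Category.comp_id p).trans hφ.symm
        comm₂ := h₁
        comm₃ := h₂ }
    exact isIso₁_of_isIso₂₃ Φ hT hT (inferInstanceAs (IsIso (𝟙 Z))) hχ

/-- The components of a right minimal right almost split morphism are irreducible. -/
lemma isIrreducibleMap_component {E Z : C} (hZ : Indecomposable Z) {p : E ⟶ Z}
    (hp : ¬ IsSplitEpi p)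
    (hlift : ∀ (W : C) (f : W ⟶ Z), ¬ IsSplitEpi f → ∃ g : W ⟶ E, g ≫ p = f)
    (hmin : ∀ φ : E ⟶ E, φ ≫ p = p → IsIso φ) {Y : C} (hY : Indecomposable Y)
    (i : Y ⟶ E) (r : E ⟶ Y) (hir : i ≫ r = 𝟙 Y) : IsIrreducibleMap (i ≫ p) := by
  have hepi : ¬ IsSplitEpi (i ≫ p) := fun h ↦ hp (isSplitEpi_of_comp _ _ h)
  refine ⟨fun h ↦ hepi ?_, hepi, fun W g h hgh ↦ ?_⟩
  · have := hZ.isIso_of_isSplitMono hY.1 (i ≫ p)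
    infer_instance
  · by_cases hh : IsSplitEpi h
    · exact Or.inr hh
    · left
      obtain ⟨l, rfl⟩ := hlift W h hh
      -- `φ` replaces `i` by `g ≫ l` on the summand `Y`; both have the same composite with `p`, so
      -- minimality applies.
      let φ : E ⟶ E := 𝟙 E - r ≫ (i - g ≫ l)
      have hφ : IsIso φ := hmin φ (by simp [φ, Preadditive.sub_comp, hgh])
      have h1 : i ≫ φ = g ≫ l := by
        simp [φ, Preadditive.comp_sub, reassoc_of% hir]
      exact ⟨⟨l ≫ inv φ ≫ r, by rw [← reassoc_of% h1]; simp [hir]⟩⟩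

lemma isAlmostVanishing_of_comp_eq_zero (hKS : IsKrullSchmidt C) {Z W : C}
    (hZ : Indecomposable Z) (hW : Indecomposable W) {f : Z ⟶ W} (hf : f ≠ 0)
    (h : ∀ (V : C) (g : V ⟶ Z), ¬ IsSplitEpi g → g ≫ f = 0) : IsAlmostVanishing f := by
  let e : W ≅ (W⟦(-1 : ℤ)⟧)⟦(1 : ℤ)⟧ := (shiftNegShift W (1 : ℤ)).symm
  obtain ⟨Y, a, b, hT⟩ := distinguished_cocone_triangle₂ (f ≫ e.hom)
  refine ⟨W⟦(-1 : ℤ)⟧, Y, a, b, e, hT, hW.shift hKS _, hZ, fun h0 ↦ hf ?_, fun V g hg ↦ ?_⟩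
  · rw [← cancel_mono e.hom, zero_comp]
    exact h0
  · change V ⟶ Z at g
    have hgf : g ≫ f ≫ e.hom = 0 := by rw [← Category.assoc, h V g hg, zero_comp]
    obtain ⟨l, hl⟩ := Triangle.coyoneda_exact₃ _ hT g hgf
    exact ⟨l, hl.symm⟩

lemma IsSerreFunctor.nonempty_iso_of_comp_eq_zero {S : C ⥤ C} (hS : IsSerreFunctor k S) {Z W : C}
    (hZ : Indecomposable Z) (hW : Indecomposable W) {f : Z ⟶ W} (hf : f ≠ 0)
    (h : ∀ (V : C) (g : V ⟶ Z), ¬ IsSplitEpi g → g ≫ f = 0) : Nonempty (W ≅ S.obj Z) := by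
  obtain ⟨hSeq, e, he₁, he₂⟩ := hS
  obtain ⟨ξ, hξ⟩ : ∃ ξ : Module.Dual k (Z ⟶ W), ξ f ≠ 0 := by
    by_contra! h0
    exact hf ((Module.forall_dual_apply_eq_zero_iff k f).1 h0)
  let U := S.objPreimage W
  let i : S.obj U ≅ W := S.objObjPreimageIso W
  obtain ⟨g, hg⟩ := S.map_surjective (i.hom ≫ e Z W ξ)
  obtain ⟨η, hη⟩ := (e U (S.obj U)).surjective (𝟙 _)
  -- Both functionals correspond to `S.map g`. Evaluated at `f ≫ i.inv`, the right side is `ξ f ≠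
  -- 0`, so `g ≫ f ≠ 0` and `g` must split.
  have key : η ∘ₗ Linear.leftComp k (S.obj U) g = ξ ∘ₗ Linear.rightComp k Z i.hom := by
    apply (e Z (S.obj U)).injective
    rw [he₁, he₂, hη, hg, Category.id_comp]
  have hne : g ≫ f ≠ 0 := fun h0 ↦ hξ (by
    have := LinearMap.congr_fun key (f ≫ i.inv)
    simpa [reassoc_of% h0] using this.symm)
  have hsplit : IsSplitEpi g := by
    by_contra hg
    exact hne (h U g hg)
  have : IsSplitEpi (S.map g) := inferInstance
  have : IsSplitEpi (i.inv ≫ S.map g) := inferInstance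
  have hSZ : ¬ IsZero (S.obj Z) := fun h0 ↦ hZ.1 (by
    have : S.Additive := S.additive_of_preserves_binary_products
    rw [IsZero.iff_id_eq_zero] at h0 ⊢
    exact S.map_injective (by simpa using h0))
  have := hW.isIso_of_isSplitEpi hSZ (i.inv ≫ S.map g)
  exact ⟨asIso (i.inv ≫ S.map g)⟩

/-- A natural transformation supported on the shift orbit of `M` kills radical maps to shifts
of `M`. -/
lemma comp_app_eq_zero (hKS : IsKrullSchmidt C) {S : C ⥤ C} (hS : IsSerreFunctor k S) {M : C}
    (hM : Indecomposable M) (hirr : ∀ (r : ℤ) (f : M⟦r⟧ ⟶ M), ¬ IsIrreducibleMap f)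
    {F : C ⥤ C} (α : 𝟭 C ⟶ F) (hα : natSupport α ⊆ shiftOrbit M) (r : ℤ) (V : C)
    (g : V ⟶ M⟦r⟧) (hg : ¬ IsSplitEpi g) : g ≫ α.app (M⟦r⟧) = 0 := by
  have hZ := hM.shift hKS r
  obtain ⟨E, p, hp, hlift, hmin⟩ := exists_rightMinimal_rightAlmostSplit hKS hS hZ
  have hE : α.app E = 0 := by
    refine app_eq_zero_of_indecomposable hKS α E fun Y i q hiq hY ↦ ?_
    by_contra hne
    exact not_mem_shiftOrbit_of_isIrreducibleMap hirr
      (isIrreducibleMap_component hZ hp hlift hmin hY i q hiq) (hα ⟨hY, hne⟩)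
  obtain ⟨l, rfl⟩ := hlift V g hg
  have := α.naturality p
  dsimp at this
  rw [Category.assoc, this, hE, zero_comp, comp_zero]

end Triangulated

end ARTheory

theorem mainTheorem3 {k : Type w} [Field k] [IsAlgClosed k]
    {C : Type u} [Category.{v} C] [HasZeroObject C] [HasShift C ℤ] [Preadditive C]
    [∀ n : ℤ, (shiftFunctor C n).Additive] [Pretriangulated C] [IsTriangulated C]
    [Linear k C] [∀ n : ℤ, (shiftFunctor C n).Linear k]
    (hfin : ∀ X Y : C, Module.Finite k (X ⟶ Y))
    (hKS : ARTheory.IsKrullSchmidt C)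
    (S : C ⥤ C) (hS : ARTheory.IsSerreFunctor k S)
    (M : C) (hM : Indecomposable M)
    (hirr : ∀ (r : ℤ) (f : M⟦r⟧ ⟶ M), ¬ ARTheory.IsIrreducibleMap f)
    (F : C ⥤ C) [F.Additive] [F.Linear k]
    (hF : ∀ r : ℤ, Indecomposable (F.obj (M⟦r⟧)))
    (α : 𝟭 C ⟶ F)
    (hα : ARTheory.natSupport α ⊆ ARTheory.shiftOrbit M) :
    (∀ r : ℤ, α.app (M⟦r⟧) ≠ 0 →
      Nonempty (F.obj (M⟦r⟧) ≅ S.obj (M⟦r⟧)) ∧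
        ARTheory.IsAlmostVanishing (α.app (M⟦r⟧))) ∧
    ((ARTheory.natSupport α = ARTheory.shiftOrbit M ∨
        (α ≠ 0 ∧ ARTheory.CommutesWithShiftUpToSign α)) →
      Nonempty (F.obj M ≅ S.obj M) ∧
        (∀ r : ℤ, ARTheory.IsAlmostVanishing (α.app (M⟦r⟧))) ∧
        ARTheory.IsLinckelmannTransformation S M α) := by
  have part1 (r : ℤ) (hr : α.app (M⟦r⟧) ≠ 0) :
      Nonempty (F.obj (M⟦r⟧) ≅ S.obj (M⟦r⟧)) ∧ ARTheory.IsAlmostVanishing (α.app (M⟦r⟧)) := by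
    have hZ := hM.shift hKS r
    have h := ARTheory.comp_app_eq_zero hKS hS hM hirr α hα r
    exact ⟨hS.nonempty_iso_of_comp_eq_zero hZ (hF r) hr h,
      ARTheory.isAlmostVanishing_of_comp_eq_zero hKS hZ (hF r) hr h⟩
  refine ⟨part1, fun h ↦ ?_⟩
  have hne (r : ℤ) : α.app (M⟦r⟧) ≠ 0 := by
    rcases h with h | ⟨h0, h⟩
    · exact (h.symm ▸ (⟨r, ⟨Iso.refl _⟩⟩ : M⟦r⟧ ∈ ARTheory.shiftOrbit M) :
        M⟦r⟧ ∈ ARTheory.natSupport α).2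
    · intro hr
      -- Vanishing at one shift spreads to the whole orbit, hence to all indecomposables,
      -- contradicting `α ≠ 0`.
      refine h0 (NatTrans.ext (funext fun X ↦ ?_))
      refine ARTheory.app_eq_zero_of_indecomposable hKS α X fun Y _ _ _ hY ↦ ?_
      by_contra hYne
      obtain ⟨s, ⟨i⟩⟩ := hα ⟨hY, hYne⟩
      rw [ARTheory.app_eq_zero_iff_of_iso α i, h.app_shift_eq_zero_iff] at hYne
      exact hYne ((h.app_shift_eq_zero_iff M r).1 hr)
  refine ⟨?_, fun r ↦ (part1 r (hne r)).2, fun r ↦ (part1 r (hne r)).1,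
    fun r ↦ (part1 r (hne r)).2, fun V hV hVM ↦ ?_⟩
  · obtain ⟨i⟩ := (part1 0 (hne 0)).1
    exact ⟨F.mapIso (shiftZero ℤ M).symm ≪≫ i ≪≫ S.mapIso (shiftZero ℤ M)⟩
  · by_contra h0
    exact hVM (hα ⟨hV, h0⟩)
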